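/- **Setting.** All Hilbert spaces are complex; inner products are linear in the first variable. Let $H_1,H_2,K$ be Hilbert spaces, $H:=H_1\otimes H_2$ and $\mathcal H:=K\otimes H$ (Hilbert tensor products). $\mathcal B_2(E,F)$ denotes the Hilbert space of Hilbert--Schmidt operators $E\to F$ with $\langle X,Y\rangle=\operatorname{Tr}(XY^*)$, and $|x\rangle\langle y|$ is the operator $z\mapsto\langle z,y\rangle x$. $E^\#$ is the conjugate space of $E$ (same additive group, $\lambda * y=\overline\lambda y$, $\langle x,y\rangle_{E^\#}=\langle y,x\rangle_E$), $\mathcal C_E:E\to E^\#$, $y\mapsto\overline y$, is the (conjugate linear) identity map, and $Q^\#:=\mathcal C_E\,Q^*\,\mathcal C_F^{-1}:F^\#\to E^\#$ for a bounded $Q:E\to F$. The map $\mathrm{vec}:\mathcal B_2(H_1^\#,H_2)\to H_1\otimes H_2$ is the linear isometric isomorphism with $\mathrm{vec}(|y\rangle\langle\overline x|)=x\otimes y$. Let $w\in\mathcal H$ and $T:=|w\rangle\langle w|$. For an orthonormal basis $e=\{e_i\}_{i\in I}$ of $K$ define: * the slices $T_{ij}$ of $T$ by $\langle T_{ij}\eta,\xi\rangle=\langle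 T(e_j\otimes\eta),e_i\otimes\xi\rangle$ for $\xi,\eta\in H$, and, for $P\in\mathcal B_2(H_1)$ and $Q\in\mathcal B_2(H_2)$, the bounded operator $P\star Q$ on $K$ by $\langle (P\star Q)e_j,e_i\rangle=\langle P\otimes Q,T_{ij}\rangle_{\mathcal B_2(H)}$; * the linear isometric isomorphism $C_e:K\to K^\#$, $C_e\big(\sum_i x_ie_i\big)=\sum_i x_i*\overline{e_i}$. Let $\mathcal W:K^\#\to H^\#$ be the bounded conjugate linear operator with $\langle\mathcal W\overline\xi,\overline h\rangle_{H^\#}=\langle(\mathcal C_K\otimes\mathcal C_H)w,\overline\xi\otimes\overline h\rangle_{K^\#\otimes H^\#}$ for all $\xi\in K$, $h\in H$, and define $$P\star_wQ:=(\mathcal C_H^{-1}\mathcal W)^*(P\otimes Q)(\mathcal C_H^{-1}\mathcal W)\in\mathcal B(K^\#).$$ **Theorem.** 1. For every orthonormal basis $e$ of $K$ and all $P\in\mathcal B_2(H_1)$, $Q\in\mathcal B_2(H_2)$: $\;P\star Q=C_e^*\,(P\star_wQ)\,C_e$. 2. If $w=\sum_{i\in I}e_i\otimes u_i$ with $e$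 an orthonormal basis of $K$ and $u_i\in H$, then for every $x\in H$ the series $\phi_w(x):=\sum_{i\in I}\langle x,u_i\rangle*\overline{e_i}$ converges in $K^\#$, and its sum depends only on $w$ and $x$: if also $w=\sum_{j\in J}f_j\otimes v_j$ for another orthonormal basis $\{f_j\}_{j\in J}$ of $K$, then $\sum_i\langle x,u_i\rangle*\overline{e_i}=\sum_j\langle x,v_j\rangle*\overline{f_j}$. Moreover, for every Hilbert space $\widetilde{\mathcal H}$ and all $A\in\mathcal B_2(\widetilde{\mathcal H},H_1)$, $B\in\mathcal B_2(\widetilde{\mathcal H}^\#,H_2)$, the series $\rho:=\sum_{i\in I}\langle\mathrm{vec}(BA^\#),u_i\rangle\,e_i$ converges in $K$ and $$\rho=C_e^*\,\phi_w\big(\mathrm{vec}(BA^\#)\big).$$ 3. Let $\mathbf r(\star):=\sup\{\operatorname{rk}X:X\in\mathcal U(\star)\}\in\mathbb N\cup\{\infty\}$, where $\mathcal U(\star)\subset\mathcal B_2(H_1^\#,H_2)$ is the closed linear span (in the Hilbert--Schmidt norm) of $\{\mathrm{vec}^{-1}(u_i):i\in I\}$ and $\operatorname{rk}X$ is the dimension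 of the closure of the range of $X$ ($\infty$ if infinite). Then $\mathbf r(\star)$ does not depend on the decomposition $w=\sum_{i\in I}e_i\otimes u_i$: two decompositions with respect to two orthonormal bases of $K$ give the same value. -/

import Mathlib

set_option linter.unusedSectionVars false

open scoped TensorProduct InnerProductSpace ComplexConjugate ENNReal

noncomputable section

namespace HilbertSchur

/-! Mathlib's inner product `⟪x, y⟫_ℂ` is conjugate linear in `x` and linear in `y`; an inner
product `⟨x, y⟩` that is linear in the first variable is therefore written `⟪y, x⟫_ℂ` below. -/

section ConjugateSpace

/-- The conjugate space of `H`: the same additive group, with scalar multiplication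
`c * y := conj c • y` and with the inner product of `H` with its arguments exchanged. -/
def ConjSpace (H : Type*) : Type _ := H

variable {H : Type*} [NormedAddCommGroup H] [InnerProductSpace ℂ H]

instance : NormedAddCommGroup (ConjSpace H) := inferInstanceAs (NormedAddCommGroup H)

instance [CompleteSpace H] : CompleteSpace (ConjSpace H) := inferInstanceAs (CompleteSpace H)

instance : Module ℂ (ConjSpace H) := Module.compHom H (starRingEnd ℂ)

/-- The identity map onto the conjugate space, as an additive map. -/
def toConjAdd : H ≃+ ConjSpace H := AddEquiv.refl H

theorem smul_toConjAdd (c : ℂ) (x : H) : c • toConjAdd x = toConjAdd (conj c • x) := rfl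

instance : NormedSpace ℂ (ConjSpace H) where
  norm_smul_le c x := by
    change ‖conj c • (toConjAdd.symm x : H)‖ ≤ ‖c‖ * ‖(toConjAdd.symm x : H)‖
    rw [norm_smul, RCLike.norm_conj]

instance : InnerProductSpace ℂ (ConjSpace H) where
  inner x y := ⟪(toConjAdd.symm y : H), toConjAdd.symm x⟫_ℂ
  norm_sq_eq_re_inner x := norm_sq_eq_re_inner (𝕜 := ℂ) (toConjAdd.symm x : H)
  conj_inner_symm x y := inner_conj_symm (𝕜 := ℂ) (toConjAdd.symm y : H) (toConjAdd.symm x)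
  add_left _ _ z := inner_add_right (𝕜 := ℂ) (toConjAdd.symm z : H) _ _
  smul_left x y c := inner_smul_right (𝕜 := ℂ) (toConjAdd.symm y : H) (toConjAdd.symm x) (conj c)

/-- The conjugation isometry `C_H : H → H^#`; it is the identity on vectors and conjugate
linear. -/
def conjIso (H : Type*) [NormedAddCommGroup H] [InnerProductSpace ℂ H] :
    H ≃ₗᵢ⋆[ℂ] ConjSpace H where
  toFun := toConjAdd
  invFun := toConjAdd.symm
  left_inv _ := rfl
  right_inv _ := rfl
  map_add' _ _ := rfl
  map_smul' c x := by
    change toConjAdd (c • x) = toConjAdd (conj (conj c) • x)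
    rw [Complex.conj_conj]
  norm_map' _ := rfl

theorem inner_conjIso (x y : H) : ⟪conjIso H x, conjIso H y⟫_ℂ = ⟪y, x⟫_ℂ := rfl

variable {K : Type*} [NormedAddCommGroup K] [InnerProductSpace ℂ K]

/-- `C_H : H → H^#` as a continuous conjugate linear map. -/
def conjL (H : Type*) [NormedAddCommGroup H] [InnerProductSpace ℂ H] : H →L⋆[ℂ] ConjSpace H :=
  (conjIso H).toContinuousLinearEquiv

/-- `C_H⁻¹ : H^# → H` as a continuous conjugate linear map. -/
def conjSymmL (H : Type*) [NormedAddCommGroup H] [InnerProductSpace ℂ H] :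
    ConjSpace H →L⋆[ℂ] H :=
  (conjIso H).symm.toContinuousLinearEquiv

theorem conjL_apply (x : H) : conjL H x = conjIso H x := rfl

theorem conjSymmL_apply (x : ConjSpace H) : conjSymmL H x = (conjIso H).symm x := rfl

variable [CompleteSpace H] [CompleteSpace K]

/-- The transposition `Q^# := C_K Q^* C_H⁻¹ : H^# → K^#` of `Q : K → H`. -/
def transpose (Q : K →L[ℂ] H) : ConjSpace H →L[ℂ] ConjSpace K :=
  ((conjL K).comp Q.adjoint).comp (conjSymmL H)

theorem transpose_apply (Q : K →L[ℂ] H) (y : H) :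
    transpose Q (conjIso H y) = conjIso K (Q.adjoint y) := rfl

/-- The conjugate `{ē_i}` of an orthonormal basis `{e_i}` of `K`, a basis of `K^#`. -/
def conjBasis {ι : Type*} (e : HilbertBasis ι ℂ K) : HilbertBasis ι ℂ (ConjSpace K) :=
  HilbertBasis.mk (v := fun i => conjIso K (e i))
    (by
      classical
      have h := orthonormal_iff_ite.1 e.orthonormal
      refine orthonormal_iff_ite.2 fun i j => ?_
      rw [inner_conjIso, h j i]
      simp only [eq_comm])
    (by
      rw [← Submodule.orthogonal_orthogonal_eq_closure, ← eq_top_iff, Submodule.orthogonal_eq_top_iff]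
      rw [eq_bot_iff]
      intro x hx
      have h0 : ∀ i, ⟪(conjIso K).symm x, e i⟫_ℂ = 0 := fun i => by
        have := hx _ (Submodule.subset_span ⟨i, rfl⟩)
        exact this
      have : (conjIso K).symm x = 0 := by
        have h1 := e.hasSum_repr ((conjIso K).symm x)
        have h2 : (fun i => e.repr ((conjIso K).symm x) i • e i) = fun _ => 0 := by
          funext i
          rw [e.repr_apply_apply, ← inner_conj_symm, h0 i]
          simp
        rw [h2] at h1
        exact h1.unique hasSum_zero
      simpa using this)

theorem conjBasis_apply {ι : Type*} (e : HilbertBasis ι ℂ K) (i : ι) :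
    conjBasis e i = conjIso K (e i) := by
  rw [conjBasis, HilbertBasis.coe_mk]

/-- The linear isometric isomorphism `C_e : K → K^#`, `∑ x_i e_i ↦ ∑ x_i * ē_i`. -/
def basisIso {ι : Type*} (e : HilbertBasis ι ℂ K) : K ≃ₗᵢ[ℂ] ConjSpace K :=
  e.repr.trans (conjBasis e).repr.symm

theorem hasSum_basisIso {ι : Type*} (e : HilbertBasis ι ℂ K) (x : K) :
    HasSum (fun i => ⟪e i, x⟫_ℂ • conjIso K (e i)) (basisIso e x) := by
  have := (conjBasis e).hasSum_repr_symm (e.repr x)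
  simp only [conjBasis_apply, e.repr_apply_apply] at this
  exact this

theorem basisIso_self {ι : Type*} (e : HilbertBasis ι ℂ K) (i : ι) :
    basisIso e (e i) = conjIso K (e i) := by
  classical
  rw [basisIso, LinearIsometryEquiv.trans_apply, e.repr_self, HilbertBasis.repr_symm_single,
    conjBasis_apply]

/-- `C_e` as a bounded operator. -/
def basisL {ι : Type*} (e : HilbertBasis ι ℂ K) : K →L[ℂ] ConjSpace K :=
  (basisIso e).toContinuousLinearEquiv

end ConjugateSpace

section TensorProducts

variable {E F E' F' : Type*} [NormedAddCommGroup E] [InnerProductSpace ℂ E]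
  [NormedAddCommGroup F] [InnerProductSpace ℂ F] [NormedAddCommGroup E'] [InnerProductSpace ℂ E']
  [NormedAddCommGroup F'] [InnerProductSpace ℂ F']

/-- The Hilbert tensor product: the completion of the algebraic tensor product with the inner
product `⟨x₁ ⊗ y₁, x₂ ⊗ y₂⟩ = ⟨x₁, x₂⟩ ⟨y₁, y₂⟩`. -/
def HTensor (E F : Type*) [NormedAddCommGroup E] [InnerProductSpace ℂ E]
    [NormedAddCommGroup F] [InnerProductSpace ℂ F] : Type _ :=
  UniformSpace.Completion (E ⊗[ℂ] F)

instance : NormedAddCommGroup (HTensor E F) :=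
  inferInstanceAs (NormedAddCommGroup (UniformSpace.Completion (E ⊗[ℂ] F)))

instance : InnerProductSpace ℂ (HTensor E F) :=
  inferInstanceAs (InnerProductSpace ℂ (UniformSpace.Completion (E ⊗[ℂ] F)))

instance : CompleteSpace (HTensor E F) :=
  inferInstanceAs (CompleteSpace (UniformSpace.Completion (E ⊗[ℂ] F)))

/-- The inclusion of the algebraic tensor product in the Hilbert tensor product. -/
def algL (E F : Type*) [NormedAddCommGroup E] [InnerProductSpace ℂ E]
    [NormedAddCommGroup F] [InnerProductSpace ℂ F] : E ⊗[ℂ] F →L[ℂ] HTensor E F :=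
  UniformSpace.Completion.toComplL

/-- The bounded bilinear map `(x, y) ↦ x ⊗ y`. -/
def tmulL (E F : Type*) [NormedAddCommGroup E] [InnerProductSpace ℂ E]
    [NormedAddCommGroup F] [InnerProductSpace ℂ F] : E →L[ℂ] F →L[ℂ] HTensor E F :=
  (ContinuousLinearMap.compL ℂ F (E ⊗[ℂ] F) (HTensor E F) (algL E F)).comp
    (TensorProduct.mkL ℂ E F)

/-- The simple tensor `x ⊗ y`. -/
def htmul (x : E) (y : F) : HTensor E F := tmulL E F x y

theorem tmulL_apply (x : E) (y : F) : tmulL E F x y = htmul x y := rfl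

theorem algL_tmul (x : E) (y : F) : algL E F (x ⊗ₜ[ℂ] y) = htmul x y := rfl

theorem denseRange_algL : DenseRange (algL E F) := UniformSpace.Completion.denseRange_coe

theorem inner_algL (s t : E ⊗[ℂ] F) : ⟪algL E F s, algL E F t⟫_ℂ = ⟪s, t⟫_ℂ :=
  UniformSpace.Completion.inner_coe s t

theorem inner_htmul (x x' : E) (y y' : F) :
    ⟪htmul x y, htmul x' y'⟫_ℂ = ⟪x, x'⟫_ℂ * ⟪y, y'⟫_ℂ := by
  rw [← algL_tmul, ← algL_tmul, inner_algL, TensorProduct.inner_tmul]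

theorem norm_htmul (x : E) (y : F) : ‖htmul x y‖ = ‖x‖ * ‖y‖ := by
  have : ‖htmul x y‖ = ‖x ⊗ₜ[ℂ] y‖ := UniformSpace.Completion.norm_coe _
  rw [this, TensorProduct.norm_tmul]

/-- A closed subspace that contains all simple tensors is the whole space. -/
theorem topologicalClosure_eq_top_of_htmul_mem (S : Submodule ℂ (HTensor E F))
    (h : ∀ x y, htmul x y ∈ S.topologicalClosure) : S.topologicalClosure = ⊤ := by
  rw [eq_top_iff]
  intro z _
  refine closure_minimal ?_ S.isClosed_topologicalClosure (denseRange_algL z)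
  rintro _ ⟨t, rfl⟩
  change algL E F t ∈ S.topologicalClosure
  induction t using TensorProduct.induction_on with
  | zero => rw [map_zero]; exact zero_mem _
  | tmul x y => exact h x y
  | add s t hs ht => rw [map_add]; exact add_mem hs ht

/-- The tensor product `P ⊗ Q` of bounded operators. -/
def tensorOp (P : E →L[ℂ] E') (Q : F →L[ℂ] F') : HTensor E F →L[ℂ] HTensor E' F' :=
  (TensorProduct.mapL P Q).completion

theorem tensorOp_htmul (P : E →L[ℂ] E') (Q : F →L[ℂ] F') (x : E) (y : F) :
    tensorOp P Q (htmul x y) = htmul (P x) (Q y) :=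
  ContinuousLinearMap.completion_apply_coe (TensorProduct.mapL P Q) (x ⊗ₜ[ℂ] y)

theorem inner_map_conj (s t : E ⊗[ℂ] F) :
    ⟪TensorProduct.map (conjL E).toLinearMap (conjL F).toLinearMap s,
      TensorProduct.map (conjL E).toLinearMap (conjL F).toLinearMap t⟫_ℂ = ⟪t, s⟫_ℂ := by
  induction s using TensorProduct.induction_on with
  | zero => simp
  | add s s' hs hs' => rw [map_add, inner_add_left, inner_add_right, hs, hs']
  | tmul x y =>
    induction t using TensorProduct.induction_on with
    | zero => simp
    | add t t' ht ht' => rw [map_add, inner_add_left, inner_add_right, ht, ht']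
    | tmul x' y' =>
      rw [TensorProduct.map_tmul, TensorProduct.map_tmul, TensorProduct.inner_tmul,
        TensorProduct.inner_tmul]
      rfl

/-- `C_E ⊗ C_F` on the algebraic tensor product. -/
def conjTensorAlg (E F : Type*) [NormedAddCommGroup E] [InnerProductSpace ℂ E]
    [NormedAddCommGroup F] [InnerProductSpace ℂ F] :
    E ⊗[ℂ] F →L⋆[ℂ] ConjSpace E ⊗[ℂ] ConjSpace F :=
  (TensorProduct.map (conjL E).toLinearMap (conjL F).toLinearMap).mkContinuous 1 fun s => by
    rw [one_mul, @norm_eq_sqrt_re_inner ℂ, inner_map_conj]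
    exact (norm_eq_sqrt_re_inner (𝕜 := ℂ) s).ge

/-- The conjugate linear map `C_E ⊗ C_F : E ⊗ F → E^# ⊗ F^#`. -/
def conjTensor (E F : Type*) [NormedAddCommGroup E] [InnerProductSpace ℂ E]
    [NormedAddCommGroup F] [InnerProductSpace ℂ F] :
    HTensor E F →L⋆[ℂ] HTensor (ConjSpace E) (ConjSpace F) :=
  (conjTensorAlg E F).completion

theorem conjTensor_htmul (x : E) (y : F) :
    conjTensor E F (htmul x y) = htmul (conjIso E x) (conjIso F y) :=
  ContinuousLinearMap.completion_apply_coe (conjTensorAlg E F) (x ⊗ₜ[ℂ] y)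

/-- For a fixed vector `z`, the conjugate linear map that sends `x` to the vector `J_x^* z`, where
`J_x y = x ⊗ y`. -/
def contract [CompleteSpace F] (z : HTensor E F) : E →L⋆[ℂ] F :=
  (((ContinuousLinearMap.apply ℂ F z).comp
    ((ContinuousLinearMap.adjoint (𝕜 := ℂ) (E := F) (F := HTensor E F)).toContinuousLinearEquiv :
      (F →L[ℂ] HTensor E F) →L⋆[ℂ] (HTensor E F →L[ℂ] F))).comp (tmulL E F))

theorem contract_eq [CompleteSpace F] (z : HTensor E F) (x : E) :
    contract z x = (tmulL E F x).adjoint z := rfl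

theorem inner_contract [CompleteSpace F] (z : HTensor E F) (x : E) (y : F) :
    ⟪y, contract z x⟫_ℂ = ⟪htmul x y, z⟫_ℂ := by
  rw [contract_eq, ContinuousLinearMap.adjoint_inner_right, tmulL_apply]

end TensorProducts

section HilbertSchmidt

variable {E F G G' : Type*} [NormedAddCommGroup E] [InnerProductSpace ℂ E] [CompleteSpace E]
  [NormedAddCommGroup F] [InnerProductSpace ℂ F] [CompleteSpace F]
  [NormedAddCommGroup G] [InnerProductSpace ℂ G] [CompleteSpace G]
  [NormedAddCommGroup G'] [InnerProductSpace ℂ G'] [CompleteSpace G']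

/-- `T` is a Hilbert--Schmidt operator: `∑ ‖T b_i‖² < ∞` for some orthonormal basis `{b_i}`. -/
def IsHilbertSchmidt (T : E →L[ℂ] F) : Prop :=
  ∃ (s : Set E) (b : HilbertBasis s ℂ E), Summable fun i => ‖T (b i)‖ ^ 2

/-- The index set of an orthonormal basis of `E` that is chosen once and for all. -/
def stdIndex (E : Type*) [NormedAddCommGroup E] [InnerProductSpace ℂ E] [CompleteSpace E] :
    Set E := (exists_hilbertBasis ℂ E).choose

/-- An orthonormal basis of `E` that is chosen once and for all. -/
def stdBasis (E : Type*) [NormedAddCommGroup E] [InnerProductSpace ℂ E] [CompleteSpace E] :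
    HilbertBasis (stdIndex E) ℂ E := (exists_hilbertBasis ℂ E).choose_spec.choose

theorem hasSum_norm_sq {ι : Type*} (b : HilbertBasis ι ℂ E) (x : E) :
    HasSum (fun i => ‖⟪b i, x⟫_ℂ‖ ^ 2) (‖x‖ ^ 2) := by
  have h := (b.hasSum_inner_mul_inner x x).mapL Complex.reCLM
  have h1 : Complex.reCLM ⟪x, x⟫_ℂ = ‖x‖ ^ 2 := (norm_sq_eq_re_inner (𝕜 := ℂ) x).symm
  rw [h1] at h
  convert! h using 1
  funext i
  rw [← inner_conj_symm x (b i), Complex.conj_mul', Complex.reCLM_apply]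
  norm_cast

theorem enorm_sq_eq_tsum {ι : Type*} (b : HilbertBasis ι ℂ E) (x : E) :
    ENNReal.ofReal (‖x‖ ^ 2) = ∑' i, ENNReal.ofReal (‖⟪b i, x⟫_ℂ‖ ^ 2) := by
  rw [← (hasSum_norm_sq b x).tsum_eq,
    ENNReal.ofReal_tsum_of_nonneg (fun _ => by positivity) (hasSum_norm_sq b x).summable]

theorem tsum_adjoint {ι κ : Type*} (b : HilbertBasis ι ℂ E) (c : HilbertBasis κ ℂ F)
    (T : E →L[ℂ] F) :
    ∑' i, ENNReal.ofReal (‖T (b i)‖ ^ 2) = ∑' j, ENNReal.ofReal (‖T.adjoint (c j)‖ ^ 2) := by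
  simp_rw [enorm_sq_eq_tsum c (T _), enorm_sq_eq_tsum b (T.adjoint _)]
  rw [ENNReal.tsum_comm]
  refine tsum_congr fun j => tsum_congr fun i => ?_
  rw [ContinuousLinearMap.adjoint_inner_right, ← inner_conj_symm, RCLike.norm_conj]

theorem tsum_basis_indep {ι κ : Type*} (b : HilbertBasis ι ℂ E) (c : HilbertBasis κ ℂ E)
    (T : E →L[ℂ] F) :
    ∑' i, ENNReal.ofReal (‖T (b i)‖ ^ 2) = ∑' j, ENNReal.ofReal (‖T (c j)‖ ^ 2) := by
  rw [tsum_adjoint b (stdBasis F), tsum_adjoint c (stdBasis F)]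

theorem summable_iff_tsum_ne_top {ι : Type*} (f : ι → ℝ) (hf : ∀ i, 0 ≤ f i) :
    Summable f ↔ ∑' i, ENNReal.ofReal (f i) ≠ ⊤ := by
  refine ⟨fun h => h.tsum_ofReal_ne_top, fun h => ?_⟩
  have := ENNReal.summable_toReal h
  simpa only [ENNReal.toReal_ofReal (hf _)] using this

theorem IsHilbertSchmidt.tsum_ne_top {T : E →L[ℂ] F} (h : IsHilbertSchmidt T) {ι : Type*}
    (b : HilbertBasis ι ℂ E) : ∑' i, ENNReal.ofReal (‖T (b i)‖ ^ 2) ≠ ⊤ := by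
  obtain ⟨s, c, hc⟩ := h
  rw [tsum_basis_indep b c]
  exact (summable_iff_tsum_ne_top _ fun _ => by positivity).1 hc

/-- The condition does not depend on the orthonormal basis. -/
theorem IsHilbertSchmidt.summable {T : E →L[ℂ] F} (h : IsHilbertSchmidt T) {ι : Type*}
    (b : HilbertBasis ι ℂ E) : Summable fun i => ‖T (b i)‖ ^ 2 :=
  (summable_iff_tsum_ne_top _ fun _ => by positivity).2 (h.tsum_ne_top b)

theorem isHilbertSchmidt_of_tsum {T : E →L[ℂ] F} {ι : Type*} (b : HilbertBasis ι ℂ E)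
    (h : ∑' i, ENNReal.ofReal (‖T (b i)‖ ^ 2) ≠ ⊤) : IsHilbertSchmidt T :=
  ⟨_, stdBasis E, (summable_iff_tsum_ne_top _ fun _ => by positivity).2
    (by rwa [tsum_basis_indep (stdBasis E) b])⟩

theorem isHilbertSchmidt_of_summable {T : E →L[ℂ] F} {ι : Type*} (b : HilbertBasis ι ℂ E)
    (h : Summable fun i => ‖T (b i)‖ ^ 2) : IsHilbertSchmidt T :=
  isHilbertSchmidt_of_tsum b ((summable_iff_tsum_ne_top _ fun _ => by positivity).1 h)

theorem IsHilbertSchmidt.adjoint {T : E →L[ℂ] F} (h : IsHilbertSchmidt T) :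
    IsHilbertSchmidt T.adjoint :=
  isHilbertSchmidt_of_tsum (stdBasis F)
    (by rw [← tsum_adjoint (stdBasis E)]; exact h.tsum_ne_top _)

theorem tsum_comp_le {ι : Type*} (b : HilbertBasis ι ℂ E) (L : F →L[ℂ] G) (T : E →L[ℂ] F) :
    ∑' i, ENNReal.ofReal (‖(L ∘L T) (b i)‖ ^ 2) ≤
      ENNReal.ofReal (‖L‖ ^ 2) * ∑' i, ENNReal.ofReal (‖T (b i)‖ ^ 2) := by
  rw [← ENNReal.tsum_mul_left]
  refine ENNReal.tsum_le_tsum fun i => ?_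
  rw [← ENNReal.ofReal_mul (by positivity), ← mul_pow]
  exact ENNReal.ofReal_le_ofReal (pow_le_pow_left₀ (norm_nonneg _) (L.le_opNorm _) 2)

theorem IsHilbertSchmidt.comp_left {T : E →L[ℂ] F} (h : IsHilbertSchmidt T) (L : F →L[ℂ] G) :
    IsHilbertSchmidt (L ∘L T) :=
  isHilbertSchmidt_of_tsum (stdBasis E)
    (ne_top_of_le_ne_top (ENNReal.mul_ne_top ENNReal.ofReal_ne_top (h.tsum_ne_top _))
      (tsum_comp_le _ L T))

theorem IsHilbertSchmidt.comp_right {T : E →L[ℂ] F} (h : IsHilbertSchmidt T) (R : G →L[ℂ] E) :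
    IsHilbertSchmidt (T ∘L R) := by
  have := (h.adjoint.comp_left R.adjoint).adjoint
  rwa [← ContinuousLinearMap.adjoint_comp, ContinuousLinearMap.adjoint_adjoint] at this

theorem isHilbertSchmidt_rankOne (x : F) (y : E) :
    IsHilbertSchmidt (InnerProductSpace.rankOne ℂ x y) := by
  refine isHilbertSchmidt_of_summable (stdBasis E) ?_
  have := (hasSum_norm_sq (stdBasis E) y).summable.mul_right (‖x‖ ^ 2)
  refine this.congr fun i => ?_
  rw [InnerProductSpace.rankOne_apply, norm_smul, mul_pow, ← inner_conj_symm, RCLike.norm_conj]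

variable (E F) in
/-- The subspace of Hilbert--Schmidt operators. -/
def hsSubmodule : Submodule ℂ (E →L[ℂ] F) where
  carrier := {T | IsHilbertSchmidt T}
  zero_mem' := isHilbertSchmidt_of_summable (stdBasis E) (by simp)
  add_mem' {S T} hS hT := by
    refine isHilbertSchmidt_of_summable (stdBasis E) ?_
    refine Summable.of_nonneg_of_le (fun _ => by positivity) (fun i => ?_)
      (((hS.summable (stdBasis E)).add (hT.summable (stdBasis E))).mul_left 2)
    have h1 : ‖S (stdBasis E i) + T (stdBasis E i)‖ ≤ ‖S (stdBasis E i)‖ + ‖T (stdBasis E i)‖ :=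
      norm_add_le _ _
    change ‖S (stdBasis E i) + T (stdBasis E i)‖ ^ 2 ≤ _
    nlinarith [sq_nonneg (‖S (stdBasis E i)‖ - ‖T (stdBasis E i)‖),
      norm_nonneg (S (stdBasis E i) + T (stdBasis E i))]
  smul_mem' c T hT := by
    refine isHilbertSchmidt_of_summable (stdBasis E) ?_
    refine ((hT.summable (stdBasis E)).mul_left (‖c‖ ^ 2)).congr fun i => ?_
    rw [smul_apply, norm_smul, mul_pow]

variable (E F) in
/-- The space `B₂(E, F)` of Hilbert--Schmidt operators `E → F`, which carries the
Hilbert--Schmidt inner product (and not the operator norm). -/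
def HSOp : Type _ := hsSubmodule E F

instance : AddCommGroup (HSOp E F) := inferInstanceAs (AddCommGroup (hsSubmodule E F))

instance : Module ℂ (HSOp E F) := inferInstanceAs (Module ℂ (hsSubmodule E F))

/-- The bounded operator that underlies an element of `B₂(E, F)`. -/
def HSOp.op : HSOp E F →ₗ[ℂ] (E →L[ℂ] F) := (hsSubmodule E F).subtype

/-- A Hilbert--Schmidt operator as an element of `B₂(E, F)`. -/
def HSOp.mk (T : E →L[ℂ] F) (h : IsHilbertSchmidt T) : HSOp E F := ⟨T, h⟩

theorem HSOp.isHilbertSchmidt (X : HSOp E F) : IsHilbertSchmidt X.op := Subtype.property X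

theorem HSOp.op_mk (T : E →L[ℂ] F) (h : IsHilbertSchmidt T) : (HSOp.mk T h).op = T := rfl

theorem HSOp.op_injective : Function.Injective (HSOp.op : HSOp E F → E →L[ℂ] F) :=
  Subtype.val_injective

/-- The sequence `(X b_i)` for an orthonormal basis `{b_i}`. -/
def HSOp.toLp {ι : Type*} (b : HilbertBasis ι ℂ E) : HSOp E F →ₗ[ℂ] lp (fun _ : ι => F) 2 where
  toFun X := ⟨fun i => X.op (b i), memℓp_gen (by
    have h := X.isHilbertSchmidt.summable b
    simpa using h)⟩
  map_add' _ _ := rfl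
  map_smul' _ _ := rfl

theorem HSOp.toLp_apply {ι : Type*} (b : HilbertBasis ι ℂ E) (X : HSOp E F) (i : ι) :
    HSOp.toLp b X i = X.op (b i) := rfl

theorem HSOp.toLp_injective {ι : Type*} (b : HilbertBasis ι ℂ E) :
    Function.Injective (HSOp.toLp b : HSOp E F → lp (fun _ : ι => F) 2) := by
  intro X Y h
  refine HSOp.op_injective (ContinuousLinearMap.ext_on
    (Submodule.dense_iff_topologicalClosure_eq_top.2 b.dense_span) ?_)
  rintro _ ⟨i, rfl⟩
  have := congrArg (fun f : lp (fun _ : ι => F) 2 => f i) h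
  exact this

/-- The Hilbert--Schmidt inner product `∑ ⟨X b_i, Y b_i⟩ = Tr (Y^* X)`. -/
@[reducible]
def hsCore : InnerProductSpace.Core ℂ (HSOp E F) where
  inner X Y := ∑' i, ⟪X.op (stdBasis E i), Y.op (stdBasis E i)⟫_ℂ
  conj_inner_symm X Y :=
    inner_conj_symm (𝕜 := ℂ) (HSOp.toLp (stdBasis E) X) (HSOp.toLp (stdBasis E) Y)
  re_inner_nonneg X := inner_self_nonneg (𝕜 := ℂ) (x := HSOp.toLp (stdBasis E) X)
  add_left X Y Z := inner_add_left (𝕜 := ℂ) (HSOp.toLp (stdBasis E) X)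
    (HSOp.toLp (stdBasis E) Y) (HSOp.toLp (stdBasis E) Z)
  smul_left X Y c := inner_smul_left (𝕜 := ℂ) (HSOp.toLp (stdBasis E) X)
    (HSOp.toLp (stdBasis E) Y) c
  definite X h := HSOp.toLp_injective (stdBasis E)
    ((inner_self_eq_zero (𝕜 := ℂ) (x := HSOp.toLp (stdBasis E) X)).1 h |>.trans (map_zero _).symm)

instance : NormedAddCommGroup (HSOp E F) := (hsCore (E := E) (F := F)).toNormedAddCommGroup

instance : InnerProductSpace ℂ (HSOp E F) := InnerProductSpace.ofCore hsCore.toCore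

theorem HSOp.norm_sq_eq_toReal {ι : Type*} (b : HilbertBasis ι ℂ E) (X : HSOp E F) :
    ‖HSOp.toLp b X‖ ^ 2 = (∑' i, ENNReal.ofReal (‖X.op (b i)‖ ^ 2)).toReal := by
  have h : ‖HSOp.toLp b X‖ ^ 2 = ∑' i, ‖X.op (b i)‖ ^ 2 := by
    have := lp.norm_rpow_eq_tsum (p := 2) (by norm_num) (HSOp.toLp b X)
    simpa [HSOp.toLp_apply] using this
  rw [h, ← ENNReal.ofReal_tsum_of_nonneg (fun _ => by positivity) (X.isHilbertSchmidt.summable b),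
    ENNReal.toReal_ofReal (tsum_nonneg fun _ => by positivity)]

theorem HSOp.norm_toLp {ι : Type*} (b : HilbertBasis ι ℂ E) (X : HSOp E F) :
    ‖HSOp.toLp b X‖ = ‖X‖ := by
  have h0 : ‖X‖ = ‖HSOp.toLp (stdBasis E) X‖ := by
    rw [@norm_eq_sqrt_re_inner ℂ, @norm_eq_sqrt_re_inner ℂ]
    rfl
  have h1 : ‖HSOp.toLp b X‖ ^ 2 = ‖HSOp.toLp (stdBasis E) X‖ ^ 2 := by
    rw [HSOp.norm_sq_eq_toReal, HSOp.norm_sq_eq_toReal, tsum_basis_indep b (stdBasis E)]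
  rw [h0]
  exact (sq_eq_sq₀ (norm_nonneg _) (norm_nonneg _)).1 h1

/-- `X ↦ (X b_i)` is an isometry of `B₂(E, F)` into `ℓ²`. -/
def HSOp.toLpIso {ι : Type*} (b : HilbertBasis ι ℂ E) : HSOp E F →ₗᵢ[ℂ] lp (fun _ : ι => F) 2 :=
  ⟨HSOp.toLp b, HSOp.norm_toLp b⟩

/-- The inner product does not depend on the orthonormal basis. -/
theorem HSOp.hasSum_inner {ι : Type*} (b : HilbertBasis ι ℂ E) (X Y : HSOp E F) :
    HasSum (fun i => ⟪X.op (b i), Y.op (b i)⟫_ℂ) ⟪X, Y⟫_ℂ := by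
  rw [← (HSOp.toLpIso b).inner_map_map X Y]
  exact lp.hasSum_inner _ _

theorem HSOp.norm_sq_eq {ι : Type*} (b : HilbertBasis ι ℂ E) (X : HSOp E F) :
    ‖X‖ ^ 2 = (∑' i, ENNReal.ofReal (‖X.op (b i)‖ ^ 2)).toReal := by
  rw [← HSOp.norm_toLp b, HSOp.norm_sq_eq_toReal]

/-- The rank-one operator `z ↦ ⟨z, y⟩ x` as a Hilbert--Schmidt operator. -/
def hsRankOne (x : F) (y : E) : HSOp E F :=
  .mk (InnerProductSpace.rankOne ℂ x y) (isHilbertSchmidt_rankOne x y)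

/-- The composition `L X R` of a Hilbert--Schmidt operator with bounded operators. -/
def HSOp.sandwich (L : F →L[ℂ] G') (X : HSOp E F) (R : G →L[ℂ] E) : HSOp G G' :=
  .mk (L ∘L X.op ∘L R) ((X.isHilbertSchmidt.comp_right R).comp_left L)

/-- The composition `X R` of a Hilbert--Schmidt operator with a bounded operator. -/
def HSOp.compRight (X : HSOp E F) (R : G →L[ℂ] E) : HSOp G F :=
  .mk (X.op ∘L R) (X.isHilbertSchmidt.comp_right R)

theorem HSOp.norm_sq_ofReal {ι : Type*} (b : HilbertBasis ι ℂ E) (X : HSOp E F) :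
    ENNReal.ofReal (‖X‖ ^ 2) = ∑' i, ENNReal.ofReal (‖X.op (b i)‖ ^ 2) := by
  rw [HSOp.norm_sq_eq b, ENNReal.ofReal_toReal (X.isHilbertSchmidt.tsum_ne_top b)]

theorem HSOp.norm_sandwich_le (L : F →L[ℂ] G') (X : HSOp E F) (R : G →L[ℂ] E) :
    ‖HSOp.sandwich L X R‖ ≤ ‖L‖ * ‖X‖ * ‖R‖ := by
  refine (sq_le_sq₀ (norm_nonneg _) (by positivity)).1 ?_
  rw [← ENNReal.ofReal_le_ofReal_iff (by positivity), HSOp.norm_sq_ofReal (stdBasis G)]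
  refine (tsum_comp_le (stdBasis G) L (X.op ∘L R)).trans ?_
  rw [tsum_adjoint (stdBasis G) (stdBasis F), ContinuousLinearMap.adjoint_comp]
  refine (mul_le_mul_right (tsum_comp_le (stdBasis F) R.adjoint X.op.adjoint) _).trans_eq ?_
  rw [← tsum_adjoint (stdBasis E), ← HSOp.norm_sq_ofReal, LinearIsometryEquiv.norm_map,
    ← ENNReal.ofReal_mul (by positivity), ← ENNReal.ofReal_mul (by positivity)]
  congr 1
  ring

end HilbertSchmidt

section Vectorization

variable {H K : Type*} [NormedAddCommGroup H] [InnerProductSpace ℂ H] [CompleteSpace H]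
  [NormedAddCommGroup K] [InnerProductSpace ℂ K] [CompleteSpace K]

/-- The isometry `y ↦ e_i ⊗ y` for a member `e_i` of an orthonormal basis. -/
def tmulIso {ι : Type*} (e : HilbertBasis ι ℂ H) (K : Type*) [NormedAddCommGroup K]
    [InnerProductSpace ℂ K] (i : ι) : K →ₗᵢ[ℂ] HTensor H K :=
  ⟨(tmulL H K (e i)).toLinearMap, fun y => by
    change ‖htmul (e i) y‖ = ‖y‖
    rw [norm_htmul, e.orthonormal.1 i, one_mul]⟩

theorem tmulIso_apply {ι : Type*} (e : HilbertBasis ι ℂ H) (i : ι) (y : K) :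
    tmulIso e K i y = htmul (e i) y := rfl

/-- `H ⊗ K` is the Hilbert sum of the subspaces `e_i ⊗ K`. -/
theorem isHilbertSum_tmulIso {ι : Type*} (e : HilbertBasis ι ℂ H) :
    IsHilbertSum ℂ (fun _ : ι => K) (fun i => tmulIso e K i) := by
  refine IsHilbertSum.mk ?_ ?_
  · intro i j hij x y
    rw [tmulIso_apply, tmulIso_apply, inner_htmul, e.orthonormal.2 hij, zero_mul]
  · refine (topologicalClosure_eq_top_of_htmul_mem _ fun x y => ?_).ge
    have h := (e.hasSum_repr x).mapL ((tmulL H K).flip y)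
    refine mem_closure_of_tendsto h (Filter.Eventually.of_forall fun s => ?_)
    refine Submodule.sum_mem _ fun i _ => ?_
    rw [map_smul]
    exact Submodule.smul_mem _ _ (Submodule.mem_iSup_of_mem i ⟨y, rfl⟩)

theorem hilbertSum_apply {ι : Type*} (e : HilbertBasis ι ℂ H) (z : HTensor H K) (i : ι) :
    (isHilbertSum_tmulIso (K := K) e).linearIsometryEquiv z i = contract z (e i) := by
  classical
  refine ext_inner_left ℂ fun y => ?_
  rw [inner_contract, ← lp.inner_single_left (𝕜 := ℂ) (G := fun _ : ι => K) i y,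
    ← (isHilbertSum_tmulIso (K := K) e).linearIsometryEquiv.symm.inner_map_map,
    LinearIsometryEquiv.symm_apply_apply, IsHilbertSum.linearIsometryEquiv_symm_apply_single,
    tmulIso_apply]

/-- The operator `H^# → K` that corresponds to `z : H ⊗ K`; it is determined by
`⟨V x̄, y⟩ = ⟨z, x ⊗ y⟩`. -/
def unvecOp (z : HTensor H K) : ConjSpace H →L[ℂ] K := (contract z).comp (conjSymmL H)

theorem inner_unvecOp (z : HTensor H K) (x : H) (y : K) :
    ⟪y, unvecOp z (conjIso H x)⟫_ℂ = ⟪htmul x y, z⟫_ℂ := inner_contract z x y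

theorem isHilbertSchmidt_unvecOp (z : HTensor H K) : IsHilbertSchmidt (unvecOp z) := by
  refine isHilbertSchmidt_of_summable (conjBasis (stdBasis H)) ?_
  have h := (lp.memℓp ((isHilbertSum_tmulIso (K := K) (stdBasis H)).linearIsometryEquiv z)).summable
    (by norm_num)
  refine h.congr fun i => ?_
  rw [hilbertSum_apply, conjBasis_apply]
  norm_cast

/-- `z ↦ unvecOp z` as an isometry `H ⊗ K → B₂(H^#, K)`. -/
def unvec (H K : Type*) [NormedAddCommGroup H] [InnerProductSpace ℂ H] [CompleteSpace H]
    [NormedAddCommGroup K] [InnerProductSpace ℂ K] [CompleteSpace K] :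
    HTensor H K →ₗᵢ[ℂ] HSOp (ConjSpace H) K where
  toFun z := .mk (unvecOp z) (isHilbertSchmidt_unvecOp z)
  map_add' z z' := HSOp.op_injective (ContinuousLinearMap.ext fun x => by
    change ((tmulL H K _).adjoint) (z + z') = (tmulL H K _).adjoint z + (tmulL H K _).adjoint z'
    rw [map_add])
  map_smul' c z := HSOp.op_injective (ContinuousLinearMap.ext fun x => by
    change ((tmulL H K _).adjoint) (c • z) = c • (tmulL H K _).adjoint z
    rw [map_smul])
  norm_map' z := by
    rw [← (isHilbertSum_tmulIso (K := K) (stdBasis H)).linearIsometryEquiv.norm_map z]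
    change ‖HSOp.mk (unvecOp z) _‖ = _
    rw [← HSOp.norm_toLp (conjBasis (stdBasis H))]
    congr 1
    ext i
    rw [hilbertSum_apply, HSOp.toLp_apply, conjBasis_apply]
    rfl

theorem unvec_op (z : HTensor H K) : (unvec H K z).op = unvecOp z := rfl

theorem unvec_surjective : Function.Surjective (unvec H K) := by
  intro X
  refine ⟨(isHilbertSum_tmulIso (K := K) (stdBasis H)).linearIsometryEquiv.symm
    (HSOp.toLp (conjBasis (stdBasis H)) X), HSOp.toLp_injective (conjBasis (stdBasis H)) ?_⟩
  ext i
  rw [HSOp.toLp_apply, unvec_op, conjBasis_apply]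
  change contract _ (stdBasis H i) = _
  rw [← hilbertSum_apply, LinearIsometryEquiv.apply_symm_apply]

/-- The vectorization isometry `vec : B₂(H^#, K) → H ⊗ K`: the linear isometric isomorphism with
`vec (z ↦ ⟨z, x̄⟩ y) = x ⊗ y`. -/
def vec : HSOp (ConjSpace H) K ≃ₗᵢ[ℂ] HTensor H K :=
  (LinearIsometryEquiv.ofSurjective (unvec H K) unvec_surjective).symm

theorem vec_unvec (z : HTensor H K) : vec (unvec H K z) = z :=
  (LinearIsometryEquiv.ofSurjective (unvec H K) unvec_surjective).symm_apply_apply z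

theorem vec_rankOne (x : H) (y : K) : vec (hsRankOne y (conjIso H x)) = htmul x y := by
  have : hsRankOne y (conjIso H x) = unvec H K (htmul x y) := by
    refine HSOp.op_injective (ContinuousLinearMap.ext fun z => ext_inner_left ℂ fun t => ?_)
    obtain ⟨z, rfl⟩ := (conjIso H).surjective z
    rw [unvec_op, inner_unvecOp, inner_htmul]
    change ⟪t, ⟪conjIso H x, conjIso H z⟫_ℂ • y⟫_ℂ = _
    rw [inner_smul_right, inner_conjIso]
  rw [this, vec_unvec]

theorem inner_vec (X : HSOp (ConjSpace H) K) (x : H) (y : K) :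
    ⟪htmul x y, vec X⟫_ℂ = ⟪y, X.op (conjIso H x)⟫_ℂ := by
  obtain ⟨z, rfl⟩ := unvec_surjective X
  rw [vec_unvec, unvec_op, inner_unvecOp]

/-- The products of the members of two orthonormal bases form an orthonormal basis. -/
def prodBasis {ι κ : Type*} (b : HilbertBasis ι ℂ H) (c : HilbertBasis κ ℂ K) :
    HilbertBasis (ι × κ) ℂ (HTensor H K) :=
  HilbertBasis.mk (v := fun p : ι × κ => htmul (b p.1) (c p.2))
    (by
      classical
      refine orthonormal_iff_ite.2 fun p q => ?_
      rw [inner_htmul, orthonormal_iff_ite.1 b.orthonormal, orthonormal_iff_ite.1 c.orthonormal]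
      by_cases h1 : p.1 = q.1 <;> by_cases h2 : p.2 = q.2 <;> simp [h1, h2, Prod.ext_iff])
    (by
      refine (topologicalClosure_eq_top_of_htmul_mem _ fun x y => ?_).ge
      have h1 : ∀ i, htmul (b i) y ∈ (Submodule.span ℂ (Set.range fun p : ι × κ =>
          htmul (b p.1) (c p.2))).topologicalClosure := fun i => by
        have h := (c.hasSum_repr y).mapL (tmulL H K (b i))
        refine mem_closure_of_tendsto h (Filter.Eventually.of_forall fun s => ?_)
        refine Submodule.sum_mem _ fun j _ => ?_
        rw [map_smul]
        exact Submodule.smul_mem _ _ (Submodule.subset_span ⟨(i, j), rfl⟩)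
      have h := (b.hasSum_repr x).mapL ((tmulL H K).flip y)
      refine (Submodule.isClosed_topologicalClosure _).mem_of_tendsto h
        (Filter.Eventually.of_forall fun s => ?_)
      refine Submodule.sum_mem _ fun i _ => ?_
      rw [map_smul]
      exact Submodule.smul_mem _ _ (h1 i))

theorem prodBasis_apply {ι κ : Type*} (b : HilbertBasis ι ℂ H) (c : HilbertBasis κ ℂ K)
    (p : ι × κ) : prodBasis b c p = htmul (b p.1) (c p.2) := by
  rw [prodBasis, HilbertBasis.coe_mk]

theorem isHilbertSchmidt_tensorOp (P : HSOp H H) (Q : HSOp K K) :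
    IsHilbertSchmidt (tensorOp P.op Q.op) := by
  refine isHilbertSchmidt_of_summable (prodBasis (stdBasis H) (stdBasis K)) ?_
  refine ((P.isHilbertSchmidt.summable (stdBasis H)).mul_of_nonneg
    (Q.isHilbertSchmidt.summable (stdBasis K)) (fun _ => by positivity)
    (fun _ => by positivity)).congr fun p => ?_
  rw [prodBasis_apply, tensorOp_htmul, norm_htmul, mul_pow]

/-- `P ⊗ Q` as an element of `B₂(H ⊗ K)`. -/
def hsTensor (P : HSOp H H) (Q : HSOp K K) : HSOp (HTensor H K) (HTensor H K) :=
  .mk (tensorOp P.op Q.op) (isHilbertSchmidt_tensorOp P Q)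

end Vectorization

section Products

variable {H K : Type*} [NormedAddCommGroup H] [InnerProductSpace ℂ H] [CompleteSpace H]
  [NormedAddCommGroup K] [InnerProductSpace ℂ K] [CompleteSpace K]

/-- The slice `T_{u,v} : H → H` of an operator `T` on `K ⊗ H`, determined by
`⟨T_{u,v} η, ξ⟩ = ⟨T (v ⊗ η), u ⊗ ξ⟩`. -/
def slice (T : HSOp (HTensor K H) (HTensor K H)) (u v : K) : HSOp H H :=
  HSOp.sandwich (tmulL K H u).adjoint T (tmulL K H v)

theorem inner_slice (T : HSOp (HTensor K H) (HTensor K H)) (u v : K) (ξ η : H) :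
    ⟪ξ, (slice T u v).op η⟫_ℂ = ⟪htmul u ξ, T.op (htmul v η)⟫_ℂ :=
  ContinuousLinearMap.adjoint_inner_right (tmulL K H u) _ _

theorem slice_op (T : HSOp (HTensor K H) (HTensor K H)) (u v : K) :
    (slice T u v).op = (tmulL K H u).adjoint ∘L T.op ∘L tmulL K H v := rfl

theorem slice_add_left (T : HSOp (HTensor K H) (HTensor K H)) (u u' v : K) :
    slice T (u + u') v = slice T u v + slice T u' v :=
  HSOp.op_injective (by simp only [map_add, slice_op, ContinuousLinearMap.add_comp])

theorem slice_add_right (T : HSOp (HTensor K H) (HTensor K H)) (u v v' : K) :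
    slice T u (v + v') = slice T u v + slice T u v' :=
  HSOp.op_injective (by simp only [map_add, slice_op, ContinuousLinearMap.comp_add])

theorem slice_smul_left (T : HSOp (HTensor K H) (HTensor K H)) (c : ℂ) (u v : K) :
    slice T (c • u) v = conj c • slice T u v :=
  HSOp.op_injective (by
    simp only [map_smul, map_smulₛₗ, slice_op, ContinuousLinearMap.smul_comp])

theorem slice_smul_right (T : HSOp (HTensor K H) (HTensor K H)) (c : ℂ) (u v : K) :
    slice T u (c • v) = c • slice T u v :=
  HSOp.op_injective (by simp only [map_smul, slice_op, ContinuousLinearMap.comp_smul])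

theorem norm_tmulL_le (u : K) : ‖tmulL K H u‖ ≤ ‖u‖ :=
  ContinuousLinearMap.opNorm_le_bound _ (norm_nonneg _) fun y => (norm_htmul u y).le

theorem norm_slice_le (T : HSOp (HTensor K H) (HTensor K H)) (u v : K) :
    ‖slice T u v‖ ≤ ‖u‖ * ‖T‖ * ‖v‖ := by
  refine (HSOp.norm_sandwich_le _ _ _).trans ?_
  rw [LinearIsometryEquiv.norm_map]
  gcongr <;> exact norm_tmulL_le _

/-- Coordinatewise conjugation `∑ x_i e_i ↦ ∑ conj x_i e_i` with respect to a basis. -/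
def basisConj {ι : Type*} (e : HilbertBasis ι ℂ K) : K →L⋆[ℂ] K :=
  (conjSymmL K).comp (basisL e)

theorem basisConj_self {ι : Type*} (e : HilbertBasis ι ℂ K) (i : ι) :
    basisConj e (e i) = e i := by
  change (conjIso K).symm (basisIso e (e i)) = e i
  rw [basisIso_self, LinearIsometryEquiv.symm_apply_apply]

theorem norm_basisConj {ι : Type*} (e : HilbertBasis ι ℂ K) (x : K) :
    ‖basisConj e x‖ = ‖x‖ := (basisIso e).norm_map x

/-- The bounded sesquilinear form with values `⟨M, T_{ij}⟩` at `(e_j, e_i)`. -/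
def starForm {ι : Type*} (e : HilbertBasis ι ℂ K) (T : HSOp (HTensor K H) (HTensor K H))
    (M : HSOp H H) : K →L⋆[ℂ] K →L[ℂ] ℂ :=
  LinearMap.mkContinuous₂
    (LinearMap.mk₂'ₛₗ (starRingEnd ℂ) (RingHom.id ℂ)
      (fun x y => ⟪M, slice T (basisConj e y) (basisConj e x)⟫_ℂ)
      (fun x x' y => by rw [map_add, slice_add_right, inner_add_right])
      (fun c x y => by rw [map_smulₛₗ, slice_smul_right, inner_smul_right, smul_eq_mul])
      (fun x y y' => by rw [map_add, slice_add_left, inner_add_right])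
      (fun c x y => by
        rw [map_smulₛₗ, slice_smul_left, inner_smul_right, Complex.conj_conj, RingHom.id_apply,
          smul_eq_mul])) (‖M‖ * ‖T‖) (fun x y => by
        refine (norm_inner_le_norm (𝕜 := ℂ) M
          (slice T (basisConj e y) (basisConj e x))).trans ?_
        rw [mul_assoc, mul_assoc]
        refine mul_le_mul_of_nonneg_left ((norm_slice_le _ _ _).trans_eq ?_) (norm_nonneg _)
        rw [norm_basisConj, norm_basisConj]
        ring)

/-- The product `P ⋆ Q : K → K` defined by `T` and the orthonormal basis `{e_i}`, as the bounded
operator whose matrix is `⟨(P ⋆ Q) e_j, e_i⟩ = ⟨P ⊗ Q, T_{ij}⟩` with `T_{ij} = T_{e_i, e_j}`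
(see `inner_starProd` and `starProd_unique`). -/
def starProd {H₁ H₂ : Type*} [NormedAddCommGroup H₁] [InnerProductSpace ℂ H₁] [CompleteSpace H₁]
    [NormedAddCommGroup H₂] [InnerProductSpace ℂ H₂] [CompleteSpace H₂] {ι : Type*}
    (e : HilbertBasis ι ℂ K)
    (T : HSOp (HTensor K (HTensor H₁ H₂)) (HTensor K (HTensor H₁ H₂)))
    (P : HSOp H₁ H₁) (Q : HSOp H₂ H₂) : K →L[ℂ] K :=
  InnerProductSpace.continuousLinearMapOfBilin (starForm e T (hsTensor P Q))

section

variable {H₁ H₂ : Type*} [NormedAddCommGroup H₁] [InnerProductSpace ℂ H₁] [CompleteSpace H₁]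
  [NormedAddCommGroup H₂] [InnerProductSpace ℂ H₂] [CompleteSpace H₂] {ι : Type*}

theorem inner_starProd (e : HilbertBasis ι ℂ K)
    (T : HSOp (HTensor K (HTensor H₁ H₂)) (HTensor K (HTensor H₁ H₂)))
    (P : HSOp H₁ H₁) (Q : HSOp H₂ H₂) (i j : ι) :
    ⟪e i, starProd e T P Q (e j)⟫_ℂ = ⟪slice T (e i) (e j), hsTensor P Q⟫_ℂ := by
  rw [← inner_conj_symm, starProd, InnerProductSpace.continuousLinearMapOfBilin_apply]
  change conj ⟪hsTensor P Q, slice T (basisConj e (e i)) (basisConj e (e j))⟫_ℂ = _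
  rw [basisConj_self, basisConj_self, inner_conj_symm]

theorem starProd_unique (e : HilbertBasis ι ℂ K)
    (T : HSOp (HTensor K (HTensor H₁ H₂)) (HTensor K (HTensor H₁ H₂)))
    (P : HSOp H₁ H₁) (Q : HSOp H₂ H₂) (S : K →L[ℂ] K)
    (hS : ∀ i j, ⟪e i, S (e j)⟫_ℂ = ⟪slice T (e i) (e j), hsTensor P Q⟫_ℂ) :
    S = starProd e T P Q := by
  refine ContinuousLinearMap.ext_on
    (Submodule.dense_iff_topologicalClosure_eq_top.2 e.dense_span) ?_
  rintro _ ⟨j, rfl⟩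
  refine e.repr.injective (lp.ext (funext fun i => ?_))
  rw [e.repr_apply_apply, e.repr_apply_apply, hS, inner_starProd]

/-- The conjugate linear operator `𝒲 : K^# → H^#` of `w : K ⊗ H`, determined by
`⟨𝒲 ξ̄, h̄⟩ = ⟨(C_K ⊗ C_H) w, ξ̄ ⊗ h̄⟩`. -/
def wOp (w : HTensor K H) : ConjSpace K →L⋆[ℂ] ConjSpace H := contract (conjTensor K H w)

theorem inner_wOp (w : HTensor K H) (ξ : ConjSpace K) (h : ConjSpace H) :
    ⟪h, wOp w ξ⟫_ℂ = ⟪htmul ξ h, conjTensor K H w⟫_ℂ := inner_contract _ _ _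

/-- The linear operator `C_H⁻¹ 𝒲 : K^# → H`. -/
def canonicalOp (w : HTensor K H) : ConjSpace K →L[ℂ] H := (conjSymmL H).comp (wOp w)

/-- The canonical product `P ⋆_w Q = (C_H⁻¹ 𝒲)^* (P ⊗ Q) (C_H⁻¹ 𝒲) : K^# → K^#`. -/
def canonicalProd (w : HTensor K (HTensor H₁ H₂)) (P : HSOp H₁ H₁) (Q : HSOp H₂ H₂) :
    ConjSpace K →L[ℂ] ConjSpace K :=
  (canonicalOp w).adjoint ∘L tensorOp P.op Q.op ∘L canonicalOp w

/-- `w = ∑ e_i ⊗ u_i`. -/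
def IsDecomposition (e : HilbertBasis ι ℂ K) (u : ι → H) (w : HTensor K H) : Prop :=
  HasSum (fun i => htmul (e i) (u i)) w

theorem exists_isDecomposition (e : HilbertBasis ι ℂ K) (w : HTensor K H) :
    ∃ u : ι → H, IsDecomposition e u w := by
  have h := (isHilbertSum_tmulIso (K := H) e).hasSum_linearIsometryEquiv_symm
    ((isHilbertSum_tmulIso (K := H) e).linearIsometryEquiv w)
  rw [LinearIsometryEquiv.symm_apply_apply] at h
  exact ⟨_, h⟩

/-- The vector `φ(x) = ∑ ⟨x, u_i⟩ * ē_i` in `K^#`. -/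
def phi (e : HilbertBasis ι ℂ K) (u : ι → H) (x : H) : ConjSpace K :=
  ∑' i, ⟪u i, x⟫_ℂ • conjIso K (e i)

/-- `B A^# ∈ B₂(H₁^#, H₂)` for `A ∈ B₂(G, H₁)` and `B ∈ B₂(G^#, H₂)`. -/
def compTranspose {G : Type*} [NormedAddCommGroup G] [InnerProductSpace ℂ G] [CompleteSpace G]
    (A : HSOp G H₁) (B : HSOp (ConjSpace G) H₂) : HSOp (ConjSpace H₁) H₂ :=
  B.compRight (transpose A.op)

/-- The vector `ρ = ∑ ⟨vec (B A^#), u_i⟩ e_i` in `K`. -/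
def rho {G : Type*} [NormedAddCommGroup G] [InnerProductSpace ℂ G] [CompleteSpace G]
    (e : HilbertBasis ι ℂ K) (u : ι → HTensor H₁ H₂)
    (A : HSOp G H₁) (B : HSOp (ConjSpace G) H₂) : K :=
  ∑' i, ⟪u i, vec (compTranspose A B)⟫_ℂ • e i

/-- The rank of a bounded operator: the dimension of the closure of its range, which is `⊤` when
that dimension is infinite. -/
def opRank (X : H →L[ℂ] K) : ℕ∞ :=
  Cardinal.toENat (Module.rank ℂ (LinearMap.range X.toLinearMap).topologicalClosure)

/-- The closed span `𝒰` of the operators `vec⁻¹(u_i)` in `B₂(H₁^#, H₂)`. -/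
def unvecSpan (u : ι → HTensor H₁ H₂) : Submodule ℂ (HSOp (ConjSpace H₁) H₂) :=
  (Submodule.span ℂ (Set.range fun i => vec.symm (u i))).topologicalClosure

/-- `𝐫 = sup {rank X : X ∈ 𝒰}`. -/
def supRank (u : ι → HTensor H₁ H₂) : ℕ∞ := ⨆ X ∈ unvecSpan u, opRank X.op

end

end Products

end HilbertSchur

end

open HilbertSchur

/-! Everything is governed by one bounded linear operator that depends on `w` alone: V := C_H⁻¹ 𝒲 :
K^# → H, which is `canonicalOp w`. The two conjugations hidden in V cancel, so V ξ̄ is the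
contraction of `w` against ξ, that is, ⟨V ξ̄, h⟩ = ⟨w, ξ ⊗ h⟩ (`canonicalOp_conjIso`). If w = ∑ e_i
⊗ u_i, orthonormality forces V ē_i = u_i (`IsDecomposition.contract_eq`). Each claim then becomes a
fact about V read in the basis {ē_i} of K^#.

Product: the slice T_ij of |w⟩⟨w| is |V ē_i⟩⟨V ē_j|, so ⟨P ⊗ Q, T_ij⟩ = ⟨(P ⊗ Q) V ē_j, V ē_i⟩. This
is the matrix of V^*(P ⊗ Q)V in the basis {ē_i}, and C_e carries e_i to ē_i.

Series: ∑ ⟨x, u_i⟩ * ē_i is the basis expansion of V^* x. Hence it converges, and its sum involves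
no basis (`IsDecomposition.hasSum_phi`). Applying C_e^*, which sends ē_i back to e_i, gives ρ.

Rank: the vectors vec⁻¹(u_i) are the images of a basis under vec⁻¹ ∘ V, so their closed span is the
closed range of that operator (`IsDecomposition.unvecSpan_eq`), again independent of the
decomposition. -/

noncomputable section

namespace HilbertSchur

/-! ### Antiunitarity of the conjugation on tensor products -/

section ConjugateTensor

variable {E F : Type*} [NormedAddCommGroup E] [InnerProductSpace ℂ E]
  [NormedAddCommGroup F] [InnerProductSpace ℂ F]

theorem conjTensor_algL (s : E ⊗[ℂ] F) :
    conjTensor E F (algL E F s) =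
      algL _ _ (TensorProduct.map (conjL E).toLinearMap (conjL F).toLinearMap s) :=
  ContinuousLinearMap.completion_apply_coe (conjTensorAlg E F) s

/-- `C_E ⊗ C_F` is antiunitary. -/
theorem inner_conjTensor (s t : HTensor E F) :
    ⟪conjTensor E F s, conjTensor E F t⟫_ℂ = ⟪t, s⟫_ℂ := by
  refine denseRange_algL.induction_on₂ (p := fun s t : HTensor E F =>
    ⟪conjTensor E F s, conjTensor E F t⟫_ℂ = ⟪t, s⟫_ℂ) ?_ ?_ s t
  · exact isClosed_eq (by fun_prop) (by fun_prop)
  · intro s t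
    rw [conjTensor_algL, conjTensor_algL, inner_algL, inner_algL, inner_map_conj]

end ConjugateTensor

/-! ### Hilbert–Schmidt pairing with rank-one operators -/

section RankOne

variable {E F : Type*} [NormedAddCommGroup E] [InnerProductSpace ℂ E] [CompleteSpace E]
  [NormedAddCommGroup F] [InnerProductSpace ℂ F] [CompleteSpace F]

/-- `Tr (|x⟩⟨y|^* M) = ⟨M y, x⟩`. -/
theorem inner_hsRankOne_left (x : F) (y : E) (M : HSOp E F) :
    ⟪hsRankOne x y, M⟫_ℂ = ⟪x, M.op y⟫_ℂ := by
  -- Expanding y = ∑ ⟪b_i, y⟫ b_i and applying ⟪x, M ·⟫ gives the Hilbert–Schmidt series term by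
  -- term: |x⟩⟨y| sends b_i to ⟪y, b_i⟫ x, and the first slot of the inner product conjugates this
  -- coefficient.
  have h := ((stdBasis E).hasSum_repr y).mapL ((innerSL ℂ x).comp M.op)
  refine (HSOp.hasSum_inner (stdBasis E) _ M).unique ?_
  refine h.congr_fun fun i => ?_
  change ⟪⟪y, stdBasis E i⟫_ℂ • x, _⟫_ℂ = _
  rw [inner_smul_left, inner_conj_symm, map_smul, smul_eq_mul, HilbertBasis.repr_apply_apply]
  rfl

end RankOne

/-! ### The canonical operator and decompositions of `w` -/

section Decompositions

variable {H K : Type*} [NormedAddCommGroup H] [InnerProductSpace ℂ H] [CompleteSpace H]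
  [NormedAddCommGroup K] [InnerProductSpace ℂ K] [CompleteSpace K] {ι : Type*}

/-- C_K ⊗ C_H exchanges the arguments of the inner product and C_H⁻¹ exchanges them back, so no
conjugation survives. This lets all later computations use `contract` in place of 𝒲. -/
theorem canonicalOp_conjIso (w : HTensor K H) (x : K) :
    canonicalOp w (conjIso K x) = contract w x := by
  refine ext_inner_left ℂ fun h => ?_
  -- Holds by definition: C_H is the identity on vectors, and the inner product of H^# is that of H
  -- with its arguments exchanged.
  have h1 : ⟪h, canonicalOp w (conjIso K x)⟫_ℂ = ⟪wOp w (conjIso K x), conjIso H h⟫_ℂ := rfl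
  rw [h1, ← inner_conj_symm, inner_wOp, ← conjTensor_htmul, inner_conjTensor, inner_conj_symm,
    inner_contract]

/-- The slices of `|w⟩⟨w|` have rank one. -/
theorem slice_hsRankOne (w : HTensor K H) (u v : K) :
    slice (hsRankOne w w) u v = hsRankOne (contract w u) (contract w v) := by
  refine HSOp.op_injective (ContinuousLinearMap.ext fun η => ext_inner_left ℂ fun ξ => ?_)
  rw [inner_slice]
  change ⟪_, ⟪w, htmul v η⟫_ℂ • w⟫_ℂ = ⟪ξ, ⟪contract w v, η⟫_ℂ • contract w u⟫_ℂ
  rw [inner_smul_right, inner_smul_right, inner_contract, ← inner_conj_symm (contract w v),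
    inner_contract, inner_conj_symm]

/-- Pairing the series for `w` with e_i ⊗ y leaves only the term of index i, by orthonormality. The
coefficients u_i are thus determined by `w` and the basis. -/
theorem IsDecomposition.contract_eq {e : HilbertBasis ι ℂ K} {u : ι → H} {w : HTensor K H}
    (h : IsDecomposition e u w) (i : ι) : contract w (e i) = u i := by
  classical
  refine ext_inner_left ℂ fun y => ?_
  rw [inner_contract]
  have hw : HasSum (fun j => htmul (e j) (u j)) w := h
  refine (hw.mapL (innerSL ℂ (htmul (e i) y))).unique ?_
  convert! hasSum_ite_eq i ⟪y, u i⟫_ℂ using 2 with j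
  rw [innerSL_apply_apply, inner_htmul, orthonormal_iff_ite.1 e.orthonormal]
  by_cases hj : j = i
  · subst hj
    simp
  · simp [hj, Ne.symm hj]

/-- The series of `φ` is the expansion of `(C_H⁻¹ 𝒲)^* x` in the basis `{ē_i}`. -/
theorem IsDecomposition.hasSum_phi {e : HilbertBasis ι ℂ K} {u : ι → H} {w : HTensor K H}
    (h : IsDecomposition e u w) (x : H) :
    HasSum (fun i => ⟪u i, x⟫_ℂ • conjIso K (e i)) ((canonicalOp w).adjoint x) := by
  refine ((conjBasis e).hasSum_repr ((canonicalOp w).adjoint x)).congr_fun fun i => ?_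
  rw [HilbertBasis.repr_apply_apply, ContinuousLinearMap.adjoint_inner_right, conjBasis_apply,
    canonicalOp_conjIso, h.contract_eq]

/-- The right-hand side mentions neither the basis nor the coefficients; this is the independence of
φ from the decomposition. -/
theorem IsDecomposition.phi_eq {e : HilbertBasis ι ℂ K} {u : ι → H} {w : HTensor K H}
    (h : IsDecomposition e u w) (x : H) : phi e u x = (canonicalOp w).adjoint x :=
  (h.hasSum_phi x).tsum_eq

/-- C_e is a surjective isometry, so its adjoint is its inverse, and C_e e_i = ē_i. -/
theorem adjoint_basisL_conjIso (e : HilbertBasis ι ℂ K) (i : ι) :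
    (basisL e).adjoint (conjIso K (e i)) = e i := by
  refine ext_inner_left ℂ fun y => ?_
  rw [ContinuousLinearMap.adjoint_inner_right, ← basisIso_self]
  exact (basisIso e).inner_map_map y (e i)

/-- The bounded operator C_e^* passes through the series of φ and turns each ē_i into e_i. With x =
vec(B A^#) this yields both the convergence of the series for ρ and its value. -/
theorem IsDecomposition.hasSum_adjoint_phi {e : HilbertBasis ι ℂ K} {u : ι → H}
    {w : HTensor K H} (h : IsDecomposition e u w) (x : H) :
    HasSum (fun i => ⟪u i, x⟫_ℂ • e i) ((basisL e).adjoint (phi e u x)) := by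
  rw [h.phi_eq]
  refine ((h.hasSum_phi x).mapL (basisL e).adjoint).congr_fun fun i => ?_
  rw [map_smul, adjoint_basisL_conjIso]

/-- The linear span of a Hilbert basis is dense and L is continuous, so the image of that span is
dense in the range of L. This is what removes the basis from the closed span 𝒰. -/
theorem topologicalClosure_span_range_comp {E F : Type*} [NormedAddCommGroup E]
    [InnerProductSpace ℂ E] [NormedAddCommGroup F] [InnerProductSpace ℂ F]
    (b : HilbertBasis ι ℂ E) (L : E →L[ℂ] F) :
    (Submodule.span ℂ (Set.range fun i => L (b i))).topologicalClosure =
      (LinearMap.range L.toLinearMap).topologicalClosure := by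
  have hspan : Submodule.span ℂ (Set.range fun i => L (b i)) =
      (Submodule.span ℂ (Set.range b)).map L.toLinearMap := by
    rw [Submodule.map_span, ← Set.range_comp]
    rfl
  refine le_antisymm (Submodule.topologicalClosure_mono ?_)
    (Submodule.topologicalClosure_minimal _ ?_ (Submodule.isClosed_topologicalClosure _))
  · rw [hspan]
    exact LinearMap.map_le_range
  -- The range is the image of ⊤, and ⊤ is rewritten as the closure of the span of the basis; a
  -- continuous map sends a closure into the closure of the image.
  · rw [hspan, LinearMap.range_eq_map, ← b.dense_span]
    exact Submodule.topologicalClosure_map L _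

end Decompositions

/-! ### The product formula and the invariance of 𝒰 -/

section MainResults

variable {H₁ H₂ K : Type*} [NormedAddCommGroup H₁] [InnerProductSpace ℂ H₁] [CompleteSpace H₁]
  [NormedAddCommGroup H₂] [InnerProductSpace ℂ H₂] [CompleteSpace H₂]
  [NormedAddCommGroup K] [InnerProductSpace ℂ K] [CompleteSpace K] {ι : Type*}

/-- A bounded operator is determined by its matrix in the basis e, so it suffices to compare
entries. With u_i the contraction of `w` against e_i, both entries equal ⟨(P ⊗ Q) u_j, u_i⟩; no
decomposition of `w` has to be chosen. -/
theorem starProd_hsRankOne (w : HTensor K (HTensor H₁ H₂)) (e : HilbertBasis ι ℂ K)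
    (P : HSOp H₁ H₁) (Q : HSOp H₂ H₂) :
    starProd e (hsRankOne w w) P Q = (basisL e).adjoint ∘L canonicalProd w P Q ∘L basisL e := by
  refine (starProd_unique e _ P Q _ fun i j => ?_).symm
  have hb : ∀ k, basisL e (e k) = conjIso K (e k) := basisIso_self e
  simp only [ContinuousLinearMap.comp_apply, canonicalProd,
    ContinuousLinearMap.adjoint_inner_right, hb, canonicalOp_conjIso]
  rw [slice_hsRankOne, inner_hsRankOne_left]
  rfl

/-- The generators vec⁻¹(u_i) are the values of vec⁻¹ ∘ V at the orthonormal basis {ē_i} of K^#, so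
their closed span is the closure of the range, an object attached to `w` alone. -/
theorem IsDecomposition.unvecSpan_eq {e : HilbertBasis ι ℂ K} {u : ι → HTensor H₁ H₂}
    {w : HTensor K (HTensor H₁ H₂)} (h : IsDecomposition e u w) :
    unvecSpan u = (LinearMap.range ((unvec H₁ H₂).toContinuousLinearMap ∘L
      canonicalOp w).toLinearMap).topologicalClosure := by
  rw [← topologicalClosure_span_range_comp (conjBasis e), unvecSpan]
  simp only [ContinuousLinearMap.comp_apply, conjBasis_apply, canonicalOp_conjIso, h.contract_eq]
  rfl

end MainResults

end HilbertSchur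

end

theorem mainTheorem9
    {H₁ H₂ K : Type*}
    [NormedAddCommGroup H₁] [InnerProductSpace ℂ H₁] [CompleteSpace H₁]
    [NormedAddCommGroup H₂] [InnerProductSpace ℂ H₂] [CompleteSpace H₂]
    [NormedAddCommGroup K] [InnerProductSpace ℂ K] [CompleteSpace K]
    (w : HTensor K (HTensor H₁ H₂))
    {ι κ : Type*} (e : HilbertBasis ι ℂ K) (f : HilbertBasis κ ℂ K)
    {G : Type*} [NormedAddCommGroup G] [InnerProductSpace ℂ G] [CompleteSpace G] :
    -- the product of `T = |w⟩⟨w|` and `{e_i}` is unitarily equivalent to the canonical product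
    (∀ (P : HSOp H₁ H₁) (Q : HSOp H₂ H₂),
      starProd e (hsRankOne w w) P Q = (basisL e).adjoint ∘L canonicalProd w P Q ∘L basisL e) ∧
    -- the series of `φ` converges, and its sum does not depend on the decomposition of `w`
    (∀ u : ι → HTensor H₁ H₂, IsDecomposition e u w →
      (∀ x, Summable fun i => ⟪u i, x⟫_ℂ • conjIso K (e i)) ∧
      ∀ v : κ → HTensor H₁ H₂, IsDecomposition f v w → ∀ x, phi e u x = phi f v x) ∧
    -- the series of `ρ` converges, and `ρ = C_e^* φ(vec (B A^#))`
    (∀ u : ι → HTensor H₁ H₂, IsDecomposition e u w →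
      ∀ (A : HSOp G H₁) (B : HSOp (ConjSpace G) H₂),
        (Summable fun i => ⟪u i, vec (compTranspose A B)⟫_ℂ • e i) ∧
        rho e u A B = (basisL e).adjoint (phi e u (vec (compTranspose A B)))) ∧
    -- `𝐫` does not depend on the decomposition of `w`
    (∀ (u : ι → HTensor H₁ H₂) (v : κ → HTensor H₁ H₂),
      IsDecomposition e u w → IsDecomposition f v w → supRank u = supRank v) := by
  refine ⟨starProd_hsRankOne w e, fun u hu => ⟨fun x => (hu.hasSum_phi x).summable,
    fun v hv x => by rw [hu.phi_eq, hv.phi_eq]⟩, fun u hu A B => ?_, fun u v hu hv => ?_⟩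
  · have h := hu.hasSum_adjoint_phi (vec (compTranspose A B))
    exact ⟨h.summable, h.tsum_eq⟩
  -- 𝐫 sees the coefficients only through their closed span, and both spans are the same closed
  -- range.
  · rw [supRank, supRank, hu.unvecSpan_eq, hv.unvecSpan_eq]
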